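/- Theorem 3.2. For a group $H$ and $n\ge 2$ let $\mathcal K(H,n)$ be the kernel of the homomorphism $H^n\to H^{\rm ab}=H/[H,H]$, $(h_1,\dots,h_n)\mapsto \overline{h_1\cdots h_n}$; for a subgroup $H'\le H$, the group $\mathcal K(H',n)$ is regarded as a subgroup of $\mathcal K(H,n)$ via $H'^n\le H^n$. For a group $G$ with a presentation $G\cong F/N$, where $F$ is a free group, put $$\widetilde{\mathcal K}(G,n):=\mathcal K(F,n)/\langle\langle \mathcal K(N,n)\rangle\rangle ,$$ where $\langle\langle \mathcal K(N,n)\rangle\rangle$ is the normal closure of $\mathcal K(N,n)$ in $F^n$. A cover (Schur representation group) of a finite group $G$ is a group $G^\ast$ with a surjective homomorphism $G^\ast\to G$ whose kernel $M$ is contained in the centre of $G^\ast$ and in $[G^\ast,G^\ast]$ and is isomorphic to the Schur multiplier $H^2(G,\mathbb C^\times)$ ($G$ acting trivially on $\mathbb C^\times$). Let $G$ be a finite group, let $G^\ast$ be a cover of $G$ and let $M$ be the kernel of $G^\ast\to G$. Then for every $n\ge 2$ and every presentation $G\cong F/N$ with $F$ free there is an isomorphism $$\mathcal K(G^\ast,n)/\mathcal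 K(M,n)\;\cong\;\widetilde{\mathcal K}(G,n).$$ In particular, up to isomorphism the group $\mathcal K(G^\ast,n)/\mathcal K(M,n)$ depends only on $G$ and $n$: any two covers of $G$ give isomorphic quotients. -/

import Mathlib

universe u v w x

/-- The homomorphism `Gⁿ → Gᵃᵇ`, `(g₁, …, gₙ) ↦` the class of the product `g₁ ⋯ gₙ`. -/
def prodAb (G : Type u) [Group G] (n : ℕ) : (Fin n → G) →* Abelianization G where
  toFun g := Abelianization.of (List.ofFn g).prod
  map_one' := by simp [map_list_prod, List.map_ofFn, List.prod_ofFn]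
  map_mul' g h := by
    simp [map_list_prod, List.map_ofFn, List.prod_ofFn, Finset.prod_mul_distrib]

/-- `𝒦(G, n)`, the kernel of `Gⁿ → Gᵃᵇ`, as a subgroup of `Gⁿ`. -/
def KGroup (G : Type u) [Group G] (n : ℕ) : Subgroup (Fin n → G) :=
  (prodAb G n).ker

/-- For a subgroup `H` of `G`, the group `𝒦(H, n)` regarded as a subgroup of `Gⁿ`
(its image under the inclusion `Hⁿ → Gⁿ`). -/
def KSub {G : Type u} [Group G] (H : Subgroup G) (n : ℕ) : Subgroup (Fin n → G) :=
  (KGroup H n).map (MonoidHom.pi fun i => H.subtype.comp (Pi.evalMonoidHom (fun _ => H) i))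

/-- `𝒦(H, n)` is contained in `𝒦(G, n)`. -/
theorem KSub_le {G : Type u} [Group G] (H : Subgroup G) (n : ℕ) : KSub H n ≤ KGroup G n := by
  rintro _ ⟨h, hh, rfl⟩
  have hh' : Abelianization.of (List.ofFn h).prod = 1 := hh
  have := congrArg (Abelianization.map H.subtype) hh'
  simp only [map_list_prod, List.map_ofFn, map_one] at this
  change Abelianization.of (List.ofFn _).prod = 1
  rw [map_list_prod, List.map_ofFn]
  exact this

/-- The normal closure `≪𝒦(N, n)≫` of `𝒦(N, n)` in the whole of `Fⁿ`. -/
def KNormalClosure {F : Type w} [Group F] (N : Subgroup F) (n : ℕ) : Subgroup (Fin n → F) :=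
  Subgroup.normalClosure (KSub N n : Set (Fin n → F))

instance {F : Type w} [Group F] (N : Subgroup F) (n : ℕ) : (KNormalClosure N n).Normal :=
  Subgroup.normalClosure_normal

/-- The normal closure is contained in `𝒦(F, n)`, so restricting it to a subgroup of
`𝒦(F, n)` loses nothing. -/
theorem KNormalClosure_le {F : Type w} [Group F] (N : Subgroup F) (n : ℕ) :
    KNormalClosure N n ≤ KGroup F n :=
  haveI : (KGroup F n).Normal := MonoidHom.normal_ker _
  Subgroup.normalClosure_le_normal (KSub_le N n)

/-- `𝒦̃(G, n) = 𝒦(F, n) / ≪𝒦(N, n)≫`, computed from `π : F → G` with kernel `N`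
(to be used for a surjection `π` from a free group `F`, i.e. a presentation `G ≅ F / N`). -/
abbrev KTilde {F : Type w} {G : Type u} [Group F] [Group G] (π : F →* G) (n : ℕ) : Type w :=
  KGroup F n ⧸ (KNormalClosure π.ker n).subgroupOf (KGroup F n)

/-- The Schur multiplier `M(G) = H²(G, ℂˣ)`, with trivial action of `G` on `ℂˣ`
(written additively; `ULift` only moves `ℤ` and `ℂˣ` into the universe of `G`). -/
noncomputable abbrev SchurMultiplier (G : Type u) [Group G] : Type u :=
  groupCohomology.H2 (Rep.trivial (ULift.{u} ℤ) G (ULift.{u} (Additive ℂˣ)))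

/-- `p : E → G` exhibits `E` as a cover (Schur representation group) of `G`: it is a surjection
whose kernel is central, lies in the commutator subgroup of `E`, and is isomorphic to the
Schur multiplier of `G`. -/
structure IsCover {E : Type v} {G : Type u} [Group E] [Group G] (p : E →* G) : Prop where
  surjective : Function.Surjective p
  central : p.ker ≤ Subgroup.center E
  le_commutator : p.ker ≤ commutator E
  equiv_multiplier : Nonempty (p.ker ≃* Multiplicative (SchurMultiplier G))

/-- For a central subgroup `M` of `E`, the subgroup `𝒦(M, n)` of `𝒦(E, n)` is normal. -/
theorem KSub_normal {E : Type v} [Group E] {M : Subgroup E} (hM : M ≤ Subgroup.center E)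
    (n : ℕ) : ((KSub M n).subgroupOf (KGroup E n)).Normal := by
  refine ⟨fun a ha g => ?_⟩
  obtain ⟨m, hm, hma⟩ := ha
  have : g * a * g⁻¹ = a := by
    rw [mul_inv_eq_iff_eq_mul]
    ext i
    have h1 : ((m i : M) : E) = (a : Fin n → E) i := congrFun hma i
    have h2 := Subgroup.mem_center_iff.1 (hM (m i).2) ((g : Fin n → E) i)
    rw [h1] at h2
    exact h2
  rw [this]
  exact ⟨m, hm, hma⟩

/-- The group `𝒦(E, n) / 𝒦(M, n)` attached to a cover `p : E → G` with kernel `M`. -/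
def CoverQuotient {E : Type v} {G : Type u} [Group E] [Group G] {p : E →* G}
    (_hp : IsCover p) (n : ℕ) : Type v :=
  KGroup E n ⧸ (KSub p.ker n).subgroupOf (KGroup E n)

instance {E : Type v} {G : Type u} [Group E] [Group G] {p : E →* G}
    (hp : IsCover p) (n : ℕ) : Group (CoverQuotient hp n) :=
  haveI := KSub_normal hp.central n
  inferInstanceAs (Group (KGroup E n ⧸ (KSub p.ker n).subgroupOf (KGroup E n)))

/-! Lift the presentation `π : F → G`, with kernel `N`, to a homomorphism `φ : F → E` into the cover.
Since the kernel `M` of `E → G` is central and contained in `[E, E]`, the lift is surjective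
(`IsCover.lift_surjective`), and it sends `N` to `M`. It therefore induces a map
`𝒦(F, n) → 𝒦(E, n) / 𝒦(M, n)`, which is surjective, with kernel the tuples of elements of `N`
whose product `x` lies in `[F, F]` and satisfies `φ x = 1`.

The kernel is identified by two facts. For `n ≥ 2` the normal closure of `𝒦(N, n)` contains all
tuples of elements of `N` with product in `[N, F]` (`mem_KNormalClosure`). And
`ker φ ∩ [F, F] ≤ [N, F]` (`IsCover.mem_commutator_ker_top`), which is where the Schur multiplier
enters: in the central extension `Q = F / [N, F]` of `G` the group `T = (N ∩ [F, F]) / [N, F]` is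
finite by Schur's theorem on commutator subgroups, and `φ` maps it onto `M`. The transgression
`Hom(T, ℂˣ) → H²(G, ℂˣ)` is injective (`exists_injective_character_to_schurMultiplier`), so
`|T| = |Hom(T, ℂˣ)| ≤ |H²(G, ℂˣ)| = |M|`, and the surjection `T → M` is bijective. -/

-- `IsMulCommutative` makes the centre of a group and its subgroups commutative groups.
open scoped IsMulCommutative commutatorElement

/-! ### Characters and central extensions -/

/-- A character of a subgroup of an abelian group extends to the whole group, since `ℂˣ` is
divisible. No finiteness is assumed. -/
theorem exists_extension_character {A : Type v} [CommGroup A] (T : Subgroup A) (χ : T →* ℂˣ) :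
    ∃ α : A →* ℂˣ, ∀ t : T, α t = χ t := by
  let : RootableBy ℂˣ ℕ := rootableByOfPowLeftSurj _ _ fun {k} hk z => by
    obtain ⟨y, hy⟩ := IsAlgClosed.exists_pow_nat_eq (z : ℂ) (Nat.pos_of_ne_zero hk)
    have hy0 : y ≠ 0 := by
      rintro rfl
      exact z.ne_zero (by rw [← hy, zero_pow hk])
    exact ⟨Units.mk0 y hy0, Units.ext hy⟩
  let : DivisibleBy (Additive ℂˣ) ℕ :=
    { div := fun a k => Additive.ofMul (RootableBy.root a.toMul k)
      div_zero := fun a => RootableBy.root_zero (α := ℕ) a.toMul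
      div_cancel := fun a hn => RootableBy.root_cancel (α := ℕ) a.toMul hn }
  let : DivisibleBy (Additive ℂˣ) ℤ := AddGroup.divisibleByIntOfDivisibleByNat _
  obtain ⟨β, hβ⟩ := (Module.Baer.of_divisible (Additive ℂˣ)).extension_property
    T.subtype.toAdditive.toIntLinearMap (fun a b h => Subtype.ext h)
    χ.toAdditive.toIntLinearMap
  exact ⟨MonoidHom.toAdditive.symm β.toAddMonoidHom, fun t => LinearMap.congr_fun hβ t⟩

section CentralExtension

variable {Q : Type v} {G : Type u} [Group Q] [Group G] {q : Q →* G}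

/-- The factor set `(g, h) ↦ s(g) s(h) s(gh)⁻¹` of a central extension `q : Q → G`, for the section
`s` of `q` given by `Function.surjInv` (not normalized: `s 1` may differ from `1`). Its values lie
in the kernel of `q`, but are taken in the centre of `Q`, which contains the kernel. -/
noncomputable def factorSet (hq : Function.Surjective q) (hc : q.ker ≤ Subgroup.center Q)
    (g h : G) : Subgroup.center Q :=
  ⟨Function.surjInv hq g * Function.surjInv hq h * (Function.surjInv hq (g * h))⁻¹,
    hc (by simp [MonoidHom.mem_ker, Function.surjInv_eq hq])⟩

theorem factorSet_cocycle (hq : Function.Surjective q) (hc : q.ker ≤ Subgroup.center Q)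
    (g h j : G) :
    factorSet hq hc (g * h) j * factorSet hq hc g h =
      factorSet hq hc h j * factorSet hq hc g (h * j) := by
  have h1 := Subgroup.mem_center_iff.1 (factorSet hq hc h j).2 (Function.surjInv hq g)
  ext
  let s := Function.surjInv hq
  calc (factorSet hq hc (g * h) j * factorSet hq hc g h : Q)
      = factorSet hq hc g h * factorSet hq hc (g * h) j :=
        Subgroup.mem_center_iff.1 (factorSet hq hc g h).2 _
    _ = s g * (factorSet hq hc h j * s (h * j)) * (s (g * (h * j)))⁻¹ := by
        simp [factorSet, mul_assoc, s]
    _ = factorSet hq hc h j * s g * s (h * j) * (s (g * (h * j)))⁻¹ := by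
        rw [← mul_assoc (s g), h1]
    _ = _ := by simp only [Subgroup.coe_mul, factorSet, mul_assoc, s]

/-- If a homomorphism `α` from the centre of `Q` makes the factor set a coboundary, then `α` is
trivial on `ker q ∩ [Q, Q]`: the cochain `b` yields an extension of `α|_{ker q}` to a homomorphism
from `Q` to an abelian group, and that one kills `[Q, Q]`. -/
theorem eq_one_of_factorSet_coboundary {C : Type w} [CommGroup C]
    (hq : Function.Surjective q) (hc : q.ker ≤ Subgroup.center Q)
    (α : Subgroup.center Q →* C) (b : G → C)
    (hb : ∀ g h, α (factorSet hq hc g h) = b h * (b (g * h))⁻¹ * b g)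
    (z : Subgroup.center Q) (hz : (z : Q) ∈ q.ker) (hz' : (z : Q) ∈ commutator Q) :
    α z = 1 := by
  let s := Function.surjInv hq
  -- Every `x : Q` is `r x * s (q x)` with `r x` in the kernel.
  let r (x : Q) : Subgroup.center Q :=
    ⟨x * (s (q x))⁻¹, hc (by simp [MonoidHom.mem_ker, s, Function.surjInv_eq hq])⟩
  have hr (x y : Q) : r (x * y) = r x * r y * factorSet hq hc (q x) (q y) := by
    ext
    have h1 : x * (r y : Q) = (r y : Q) * x := Subgroup.mem_center_iff.1 (r y).2 x
    have h2 := Subgroup.mem_center_iff.1 (r y).2 ((r x : Q))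
    simp only [Subgroup.coe_mul]
    rw [h2]
    have h3 : (r x : Q) * s (q x) = x := by simp [r]
    have h4 : (r y : Q) * s (q y) = y := by simp [r]
    calc (r (x * y) : Q) = x * y * (s (q x * q y))⁻¹ := by simp [r]
      _ = x * (r y * s (q y)) * (s (q x * q y))⁻¹ := by rw [h4]
      _ = r y * x * s (q y) * (s (q x * q y))⁻¹ := by rw [← mul_assoc, h1]
      _ = r y * (r x * s (q x)) * s (q y) * (s (q x * q y))⁻¹ := by rw [h3]
      _ = _ := by simp only [factorSet, mul_assoc, s]
  let ψ : Q →* C := MonoidHom.mk' (fun x => α (r x) * b (q x)) fun x y => by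
    simp only [hr, map_mul, hb]
    rw [mul_assoc, mul_assoc (b (q y)), mul_comm ((b (q x * q y))⁻¹), ← mul_assoc (b (q y)),
      inv_mul_cancel_right, mul_comm (b (q y)), mul_mul_mul_comm]
  have h1 : ψ z = 1 := Abelianization.commutator_subset_ker ψ hz'
  -- `r z = z * (s 1)⁻¹`, so that `ψ z = α z * ψ 1`, whether or not `s 1 = 1`.
  have hqz : q z = 1 := hz
  have h2 : r z = z * r 1 := by ext; simp [r, hqz]
  have h3 : ψ z = α z * ψ 1 := by
    simp only [ψ, MonoidHom.mk'_apply, h2, map_mul α, hqz, map_one q, mul_assoc]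
  rw [h1, map_one, mul_one] at h3
  exact h3.symm

/-- The group `ker q ∩ [Q, Q]` of a central extension `q : Q → G`, as a subgroup of the centre
of `Q`, where it is visibly abelian. -/
def kerInfCommutator (q : Q →* G) : Subgroup (Subgroup.center Q) :=
  (q.ker ⊓ commutator Q).subgroupOf (Subgroup.center Q)

/-- The transgression `Hom(ker q ∩ [Q, Q], ℂˣ) → H²(G, ℂˣ)` of a central extension is injective.
It is given as a mere map: a character is extended to the centre in some way, and applied to the
factor set. -/
theorem exists_injective_character_to_schurMultiplier
    (hq : Function.Surjective q) (hc : q.ker ≤ Subgroup.center Q) :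
    ∃ Φ : (kerInfCommutator q →* ℂˣ) → SchurMultiplier G, Function.Injective Φ := by
  choose ext hext using exists_extension_character (kerInfCommutator q)
  let f (χ : kerInfCommutator q →* ℂˣ) :
      groupCohomology.cocycles₂ (Rep.trivial (ULift.{u} ℤ) G (ULift.{u} (Additive ℂˣ))) :=
    ⟨fun p => ULift.up (Additive.ofMul (ext χ (factorSet hq hc p.1 p.2))), by
      rw [groupCohomology.mem_cocycles₂_iff]
      intro g h j
      rw [Rep.trivial_ρ_apply]
      apply ULift.down_injective
      change Additive.ofMul (ext χ _ * ext χ _) = Additive.ofMul (ext χ _ * ext χ _)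
      rw [← map_mul, ← map_mul, factorSet_cocycle]⟩
  refine ⟨fun χ => groupCohomology.H2π _ (f χ), fun χ₁ χ₂ h => ?_⟩
  obtain ⟨b, hb⟩ := (groupCohomology.H2π_eq_iff _ _).1 h
  ext ⟨z, hz⟩ : 1
  have := eq_one_of_factorSet_coboundary hq hc (ext χ₁ / ext χ₂)
    (fun g => (ULift.down (b g)).toMul) (fun g h => (congrArg
      (fun t => (ULift.down t).toMul) (congrFun hb (g, h))).symm) z hz.1 hz.2
  rw [MonoidHom.div_apply, div_eq_one] at this
  rw [← hext χ₁, ← hext χ₂]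
  exact this

/-- In a central extension, a commutator depends only on the images of its two entries. -/
theorem commutatorElement_eq_of_map_eq (hc : q.ker ≤ Subgroup.center Q) {x x' y y' : Q}
    (hx : q x = q x') (hy : q y = q y') : ⁅x, y⁆ = ⁅x', y'⁆ := by
  have key (a b c : Q) (hab : q a = q b) : ⁅a, c⁆ = ⁅b, c⁆ := by
    obtain ⟨z, hz, rfl⟩ : ∃ z ∈ Subgroup.center Q, a = b * z :=
      ⟨b⁻¹ * a, hc (by simp [MonoidHom.mem_ker, hab]), by simp⟩
    simp [commutatorElement_def, mul_assoc, ← Subgroup.mem_center_iff.1 hz c]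
  rw [key x x' y hx, ← commutatorElement_inv, key y y' x' hy, commutatorElement_inv]

/-- Schur: a central extension of a finite group has a finite commutator subgroup. -/
theorem finite_commutator_of_ker_le_center [Finite G] (hc : q.ker ≤ Subgroup.center Q) :
    Finite (commutator Q) := by
  have : Finite (commutatorSet Q) := by
    refine Set.Finite.to_subtype ((Set.finite_range
      fun p : q.range × q.range => ⁅p.1.2.choose, p.2.2.choose⁆).subset ?_)
    rintro _ ⟨x, y, rfl⟩
    exact ⟨(⟨q x, x, rfl⟩, ⟨q y, y, rfl⟩), commutatorElement_eq_of_map_eq hc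
      (Exists.choose_spec (⟨x, rfl⟩ : ∃ a, q a = q x))
      (Exists.choose_spec (⟨y, rfl⟩ : ∃ a, q a = q y))⟩
  infer_instance

/-- For a central extension `q : Q → G` of a finite group, `ker q ∩ [Q, Q]` is finite of order at most
that of the Schur multiplier, because it has as many characters as elements and its characters
embed into `H²(G, ℂˣ)`. So a surjection from it onto a group isomorphic to the multiplier is
injective. -/
theorem injective_of_surjective_to_schurMultiplier [Finite G]
    (hq : Function.Surjective q) (hc : q.ker ≤ Subgroup.center Q)
    {M : Type w} [Group M] (e : M ≃* Multiplicative (SchurMultiplier G))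
    (f : kerInfCommutator q →* M) (hf : Function.Surjective f) : Function.Injective f := by
  have := finite_commutator_of_ker_le_center hc
  have : Finite (kerInfCommutator q) :=
    Finite.of_injective (fun t => (⟨t.1.1, t.2.2⟩ : commutator Q))
      fun a b h => Subtype.ext (Subtype.ext (congrArg (fun t : commutator Q => (t : Q)) h))
  have : Finite M := Finite.of_surjective f hf
  have : Finite (SchurMultiplier G) := Finite.of_equiv M (e.toEquiv.trans Multiplicative.toAdd)
  obtain ⟨Φ, hΦ⟩ := exists_injective_character_to_schurMultiplier hq hc
  have h1 := Nat.card_le_card_of_injective Φ hΦ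
  have : NeZero (Monoid.exponent (kerInfCommutator q)) := ⟨Monoid.exponent_ne_zero_of_finite⟩
  rw [CommGroup.card_monoidHom_of_hasEnoughRootsOfUnity,
    ← Nat.card_congr (e.toEquiv.trans Multiplicative.toAdd)] at h1
  exact ((Nat.bijective_iff_surjective_and_card f).2
    ⟨hf, h1.antisymm (Nat.card_le_card_of_surjective f hf)⟩).1

end CentralExtension

/-! ### Membership in `𝒦(G, n)`, `𝒦(H, n)` and `≪𝒦(N, n)≫` -/

theorem mem_KGroup_iff {G : Type u} [Group G] {n : ℕ} {x : Fin n → G} :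
    x ∈ KGroup G n ↔ (List.ofFn x).prod ∈ commutator G := by
  rw [← Abelianization.ker_of]
  rfl

theorem mem_KSub_iff {G : Type u} [Group G] {H : Subgroup G} {n : ℕ} {x : Fin n → G} :
    x ∈ KSub H n ↔ (∀ i, x i ∈ H) ∧ (List.ofFn x).prod ∈ ⁅H, H⁆ := by
  rw [← Subgroup.map_subtype_commutator]
  constructor
  · rintro ⟨h, hh, rfl⟩
    refine ⟨fun i => (h i).2, (List.ofFn h).prod, mem_KGroup_iff.1 hh, ?_⟩
    rw [map_list_prod, List.map_ofFn]
    rfl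
  · rintro ⟨hx, y, hy, hyx⟩
    refine ⟨fun i => ⟨x i, hx i⟩, mem_KGroup_iff.2 ?_, rfl⟩
    convert! hy
    apply Subtype.ext
    rw [← H.subtype_apply, map_list_prod, List.map_ofFn, ← H.subtype_apply, hyx]
    rfl

theorem prod_ofFn_mulSingle_zero_mul {G : Type u} [Group G] {k : ℕ} (c : G)
    (x : Fin (k + 1) → G) :
    (List.ofFn (Pi.mulSingle 0 c * x)).prod = c * (List.ofFn x).prod := by
  simp [List.ofFn_succ, mul_assoc]

/-- The normal closure of `𝒦(N, n)` contains `[N, F]` in the first coordinate. A second coordinate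
is needed here: `(x, x⁻¹, 1, …)` lies in `𝒦(N, n)`, and its commutator with `(g, 1, 1, …)` is
`([x, g], 1, 1, …)`. -/
theorem mulSingle_mem_KNormalClosure {F : Type w} [Group F] {N : Subgroup F} {k : ℕ}
    {c : F} (hc : c ∈ ⁅N, (⊤ : Subgroup F)⁆) :
    Pi.mulSingle 0 c ∈ KNormalClosure N (k + 2) := by
  suffices h : ⁅N, (⊤ : Subgroup F)⁆ ≤ (KNormalClosure N (k + 2)).comap
      (MonoidHom.mulSingle (fun _ => F) 0) from h hc
  rw [Subgroup.commutator_le]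
  intro x hx g _
  let a : Fin (k + 2) → F := Fin.cons x (Fin.cons x⁻¹ 1)
  have ha : a ∈ KNormalClosure N (k + 2) := by
    refine Subgroup.subset_normalClosure (mem_KSub_iff.2 ⟨?_, ?_⟩)
    · refine Fin.cases hx (Fin.cases (N.inv_mem hx) fun i => N.one_mem)
    · simp [a, List.ofFn_succ, one_mem]
  have h1 : ⁅a, (Pi.mulSingle 0 g : Fin (k + 2) → F)⁆ = Pi.mulSingle 0 ⁅x, g⁆ := by
    ext i
    refine Fin.cases ?_ (fun i => ?_) i
    · simp [a, commutatorElement_def]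
    · simp [commutatorElement_def]
  have h2 : ⁅a, (Pi.mulSingle 0 g : Fin (k + 2) → F)⁆ =
      a * (Pi.mulSingle 0 g * a⁻¹ * (Pi.mulSingle 0 g)⁻¹) := by
    simp only [commutatorElement_def, mul_assoc]
  rw [Subgroup.mem_comap, MonoidHom.mulSingle_apply, ← h1, h2]
  exact mul_mem ha (Subgroup.Normal.conj_mem inferInstance _ (inv_mem ha) _)

/-- A tuple of elements of `N` with product in `[N, F]` lies in the normal closure of `𝒦(N, n)`:
cancelling its product in the first coordinate leaves a tuple with product `1`. -/
theorem mem_KNormalClosure {F : Type w} [Group F] {N : Subgroup F} {n : ℕ}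
    (hn : 2 ≤ n) {x : Fin n → F} (hx : ∀ i, x i ∈ N)
    (hprod : (List.ofFn x).prod ∈ ⁅N, (⊤ : Subgroup F)⁆) : x ∈ KNormalClosure N n := by
  obtain ⟨k, rfl⟩ := Nat.exists_eq_add_of_le' hn
  set c := (List.ofFn x).prod with hcdef
  have hcN : c ∈ N := list_prod_mem fun y hy => by
    obtain ⟨i, rfl⟩ := (List.mem_ofFn' _ _).1 hy
    exact hx i
  have h1 : Pi.mulSingle 0 c⁻¹ * x ∈ KNormalClosure N (k + 2) := by
    refine Subgroup.subset_normalClosure (mem_KSub_iff.2 ⟨?_, ?_⟩)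
    · refine Fin.cases ?_ fun i => ?_
      · simpa using mul_mem (inv_mem hcN) (hx 0)
      · simpa using hx i.succ
    · rw [prod_ofFn_mulSingle_zero_mul, ← hcdef, inv_mul_cancel]
      exact one_mem _
  have h2 := mul_mem (mulSingle_mem_KNormalClosure (k := k) hprod) h1
  rwa [← mul_assoc, ← Pi.mulSingle_mul, mul_inv_cancel, Pi.mulSingle_one, one_mul] at h2

/-! ### Lifting a presentation to a cover -/

section Cover

variable {G : Type u} [Group G] {E : Type v} [Group E] {p : E →* G} {F : Type w} [Group F]
  {π : F →* G} {φ : F →* E}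

/-- Every lift `φ : F → E` of a surjection `π : F → G` to a cover `E` of `G` is surjective:
`E` is generated by `φ(F)` and the kernel `M` of `E → G`, and as `M` is central,
`M ≤ [E, E] = [φ(F), φ(F)]`. -/
theorem IsCover.lift_surjective (hp : IsCover p) (hπ : Function.Surjective π)
    (hφ : ∀ f, p (φ f) = π f) : Function.Surjective φ := by
  have h1 : commutator E ≤ φ.range := by
    rw [commutator_def, Subgroup.commutator_le]
    intro x _ y _
    obtain ⟨f, hf⟩ := hπ (p x)
    obtain ⟨g, hg⟩ := hπ (p y)
    exact ⟨⁅f, g⁆, by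
      rw [map_commutatorElement, commutatorElement_eq_of_map_eq hp.central] <;> simp [*]⟩
  intro e
  obtain ⟨f, hf⟩ := hπ (p e)
  obtain ⟨g, hg⟩ := h1 (hp.le_commutator
    (show (φ f)⁻¹ * e ∈ p.ker by simp [MonoidHom.mem_ker, hφ, hf]))
  exact ⟨f * g, by simp [hg]⟩

theorem map_commutator_of_surjective (hφ : Function.Surjective φ) :
    (commutator F).map φ = commutator E := by
  rw [commutator_def, Subgroup.map_commutator, ← MonoidHom.range_eq_map,
    MonoidHom.range_eq_top.2 hφ, commutator_def]

/-- A lift `φ : F → E` of `π : F → G`, `N = ker π`, to a cover `E` of the finite group `G` satisfies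
`ker φ ∩ [F, F] ≤ [N, F]`: it maps `(N ∩ [F, F]) / [N, F]` onto the kernel of `E → G`, and this
surjection is injective by `injective_of_surjective_to_schurMultiplier`. -/
theorem IsCover.mem_commutator_ker_top [Finite G] (hp : IsCover p) (hπ : Function.Surjective π)
    (hφ : ∀ f, p (φ f) = π f) {x : F} (hx : x ∈ commutator F) (hx1 : φ x = 1) :
    x ∈ ⁅π.ker, (⊤ : Subgroup F)⁆ := by
  have hsurj := hp.lift_surjective hπ hφ
  -- The central extension of `G` obtained from `F` is `F / [N, F]`, and `φ` factors through it.
  let R := ⁅π.ker, (⊤ : Subgroup F)⁆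
  let q : F ⧸ R →* G := QuotientGroup.lift R π (Subgroup.commutator_le_left _ _)
  have hR : R ≤ φ.ker := by
    refine Subgroup.commutator_le.2 fun y hy g _ => ?_
    rw [MonoidHom.mem_ker, map_commutatorElement, commutatorElement_eq_one_iff_mul_comm]
    exact (Subgroup.mem_center_iff.1 (hp.central (MonoidHom.mem_ker.2 ((hφ y).trans hy))) _).symm
  let ψ : F ⧸ R →* E := QuotientGroup.lift R φ hR
  have hq : Function.Surjective q := fun g => (hπ g).imp' QuotientGroup.mk fun _ h => h
  have hc : q.ker ≤ Subgroup.center (F ⧸ R) := by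
    intro a ha
    induction a using QuotientGroup.induction_on with | H a =>
    refine Subgroup.mem_center_iff.2 fun b => ?_
    induction b using QuotientGroup.induction_on with | H b =>
    rw [← commutatorElement_eq_one_iff_mul_comm]
    refine (QuotientGroup.eq_one_iff ⁅b, a⁆).2 ?_
    rw [← commutatorElement_inv]
    exact inv_mem (Subgroup.commutator_mem_commutator ha (Subgroup.mem_top b))
  have hpψ (a : F ⧸ R) : p (ψ a) = q a := by
    induction a using QuotientGroup.induction_on with | H a =>
    exact hφ a
  let f : kerInfCommutator q →* p.ker :=
    (ψ.comp ((Subgroup.center (F ⧸ R)).subtype.comp (kerInfCommutator q).subtype)).codRestrict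
      p.ker fun t => (hpψ _).trans t.2.1
  have hmk (y : F) (hy : y ∈ commutator F) : (y : F ⧸ R) ∈ commutator (F ⧸ R) := by
    rw [← map_commutator_of_surjective (QuotientGroup.mk'_surjective R)]
    exact ⟨y, hy, rfl⟩
  have hker (y : F) (hy : φ y ∈ p.ker) : (y : F ⧸ R) ∈ q.ker := (hφ y).symm.trans hy
  have hf : Function.Surjective f := by
    rintro ⟨m, hm⟩
    have hm' := hp.le_commutator hm
    rw [← map_commutator_of_surjective hsurj] at hm'
    obtain ⟨y, hy, rfl⟩ := hm'
    exact ⟨⟨⟨y, hc (hker y hm)⟩, hker y hm, hmk y hy⟩, rfl⟩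
  have hxk : φ x ∈ p.ker := by rw [hx1]; exact one_mem _
  have hinj := injective_of_surjective_to_schurMultiplier hq hc hp.equiv_multiplier.some f hf
  have h1 : (⟨⟨x, hc (hker x hxk)⟩, hker x hxk, hmk x hx⟩ : kerInfCommutator q) = 1 :=
    (injective_iff_map_eq_one f).1 hinj _ (Subtype.ext hx1)
  exact (QuotientGroup.eq_one_iff x).1 (congrArg (fun t => (t.1 : F ⧸ R)) h1)

/-- For a presentation `π : F → G` and a lift `φ : F → E` of it to a cover, the map
`𝒦(F, n) → 𝒦(E, n) / 𝒦(M, n)` induced by `φ` is surjective with kernel `≪𝒦(ker π, n)≫`. -/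
theorem IsCover.nonempty_mulEquiv_KTilde [Finite G] (hp : IsCover p) {n : ℕ} (hn : 2 ≤ n)
    [IsFreeGroup F] (π : F →* G) (hπ : Function.Surjective π) :
    Nonempty (CoverQuotient hp n ≃* KTilde π n) := by
  let φ : F →* E := IsFreeGroup.lift fun a => Function.surjInv hp.surjective (π (IsFreeGroup.of a))
  have hφ (f : F) : p (φ f) = π f := by
    refine DFunLike.congr_fun (f := p.comp φ) (IsFreeGroup.ext_hom fun a => ?_) f
    simp [φ, Function.surjInv_eq]
  have hsurj := hp.lift_surjective hπ hφ
  let Φ : (Fin n → F) →* (Fin n → E) := φ.compLeft (Fin n)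
  have hprod (x : Fin n → F) : (List.ofFn (Φ x)).prod = φ (List.ofFn x).prod := by
    rw [map_list_prod, List.map_ofFn]
    rfl
  have hcomm : ⁅p.ker, p.ker⁆ = ⊥ := by
    rw [Subgroup.commutator_eq_bot_iff_le_centralizer]
    exact hp.central.trans (Subgroup.center_le_centralizer _)
  have hM : (KSub p.ker n).Normal := by
    refine ⟨fun a ha g => ?_⟩
    have : g * a * g⁻¹ = a := by
      rw [mul_inv_eq_iff_eq_mul]
      ext i
      exact Subgroup.mem_center_iff.1 (hp.central ((mem_KSub_iff.1 ha).1 i)) (g i)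
    rwa [this]
  have hK (x : Fin n → F) (hx : x ∈ KGroup F n) : Φ x ∈ KGroup E n := by
    rw [mem_KGroup_iff] at hx ⊢
    rw [hprod, ← map_commutator_of_surjective hsurj]
    exact ⟨_, hx, rfl⟩
  have hle : KNormalClosure π.ker n ≤ (KSub p.ker n).comap Φ := by
    refine Subgroup.normalClosure_le_normal fun x hx => ?_
    obtain ⟨hx1, hx2⟩ := mem_KSub_iff.1 hx
    refine mem_KSub_iff.2 ⟨fun i => (hφ _).trans (hx1 i), ?_⟩
    rw [hprod]
    have := Subgroup.mem_map_of_mem φ hx2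
    rw [Subgroup.map_commutator] at this
    have hmap : π.ker.map φ ≤ p.ker := by
      rintro _ ⟨y, hy, rfl⟩
      exact (hφ y).trans hy
    exact Subgroup.commutator_mono hmap hmap this
  have := KSub_normal hp.central n
  let Ψ : KGroup F n →* KGroup E n ⧸ (KSub p.ker n).subgroupOf (KGroup E n) :=
    (QuotientGroup.mk' _).comp ((Φ.comp (KGroup F n).subtype).codRestrict _ fun x => hK x x.2)
  have hker : Ψ.ker = (KNormalClosure π.ker n).subgroupOf (KGroup F n) := by
    ext ⟨x, hx⟩
    refine (QuotientGroup.eq_one_iff _).trans ?_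
    change Φ x ∈ KSub p.ker n ↔ x ∈ KNormalClosure π.ker n
    refine ⟨fun h => ?_, fun h => hle h⟩
    rw [mem_KSub_iff, hcomm, Subgroup.mem_bot, hprod] at h
    exact mem_KNormalClosure hn (fun i => (hφ _).symm.trans (h.1 i))
      (hp.mem_commutator_ker_top hπ hφ (mem_KGroup_iff.1 hx) h.2)
  have hΨ : Function.Surjective Ψ := by
    refine (QuotientGroup.mk'_surjective _).comp ?_
    rintro ⟨e, he⟩
    obtain ⟨k, rfl⟩ := Nat.exists_eq_add_of_le' hn
    -- A lift `f` of `e` need not lie in `𝒦(F, n)`, but its product has the same image in `E` as some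
    -- `z ∈ [F, F]`; the first coordinate of `f` is corrected by an element of `ker φ`.
    choose f hf using fun i => hsurj (e i)
    have hΦf : Φ f = e := funext hf
    rw [mem_KGroup_iff, ← map_commutator_of_surjective hsurj, ← hΦf, hprod] at he
    obtain ⟨z, hz, hzf⟩ := he
    refine ⟨⟨Pi.mulSingle 0 (z * (List.ofFn f).prod⁻¹) * f, mem_KGroup_iff.2 ?_⟩, Subtype.ext ?_⟩
    · rwa [prod_ofFn_mulSingle_zero_mul, inv_mul_cancel_right]
    · change Φ (Pi.mulSingle 0 (z * (List.ofFn f).prod⁻¹) * f) = e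
      rw [map_mul, hΦf]
      have : Φ (Pi.mulSingle 0 (z * (List.ofFn f).prod⁻¹)) = 1 := by
        ext i
        refine Fin.cases ?_ (fun i => ?_) i
        · change φ ((Pi.mulSingle 0 _ : Fin (k + 2) → F) 0) = 1
          rw [Pi.mulSingle_eq_same, map_mul, hzf, map_inv, mul_inv_cancel]
        · simp [Φ]
      rw [this, one_mul]
  exact ⟨((QuotientGroup.quotientMulEquivOfEq hker.symm).trans
    (QuotientGroup.quotientKerEquivOfSurjective Ψ hΨ)).symm⟩

end Cover

theorem theorem3p2 {G : Type u} [Group G] [Finite G] {E : Type v} [Group E] {p : E →* G}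
    (hp : IsCover p) (n : ℕ) (hn : 2 ≤ n) :
    (∀ (F : Type w) [Group F] [IsFreeGroup F] (π : F →* G), Function.Surjective π →
      Nonempty (CoverQuotient hp n ≃* KTilde π n)) ∧
    (∀ (E' : Type x) [Group E'] (p' : E' →* G) (hp' : IsCover p'),
      Nonempty (CoverQuotient hp n ≃* CoverQuotient hp' n)) := by
  refine ⟨fun F _ _ π hπ => hp.nonempty_mulEquiv_KTilde hn π hπ, fun E' _ p' hp' => ?_⟩
  -- Both quotients are compared with `𝒦̃(G, n)` for one and the same presentation of `G`.
  have hπ : Function.Surjective (FreeGroup.lift (id : G → G)) := fun g => ⟨FreeGroup.of g, by simp⟩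
  obtain ⟨e⟩ := hp.nonempty_mulEquiv_KTilde hn _ hπ
  obtain ⟨e'⟩ := hp'.nonempty_mulEquiv_KTilde hn _ hπ
  exact ⟨e.trans e'.symm⟩
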